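/- Let $d\ge 1$ and $p_1,\dots,p_d\ge 1$ be integers, and let $X=(X_1,\dots,X_d)$ be a random vector in $\mathbb{R}^{p}$, $p=p_1+\dots+p_d$, with components $X_j\in\mathbb{R}^{p_j}$. Let $X^1,X^2,\dots$ be independent random vectors, each with the distribution of $X$, and for $n\ge 1$ put $\mathbf{X}=(X^1,\dots,X^n)$. For random vectors $Y\in\mathbb{R}^{a}$ and $Z\in\mathbb{R}^{b}$ on a common probability space, the squared distance covariance is $$\mathcal{V}^2((Y,Z))=\int_{\mathbb{R}^{a}\times\mathbb{R}^{b}}\bigl|\mathrm{E}\,e^{i\langle t,Y\rangle+i\langle s,Z\rangle}-\mathrm{E}\,e^{i\langle t,Y\rangle}\,\mathrm{E}\,e^{i\langle s,Z\rangle}\bigr|^2\,\frac{dt\,ds}{K_aK_b|t|^{a+1}|s|^{b+1}},\qquad K_q=\frac{\pi^{(q+1)/2}}{\Gamma((q+1)/2)},$$ where $|\cdot|$ is the Euclidean norm. For a sample $(Y^1,Z^1),\dots,(Y^n,Z^n)$ its empirical version $\mathcal{V}_n^2((\mathbf{Y},\mathbf{Z}))$ is the same integral with the three characteristic functions replaced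 by the empirical ones $\frac1n\sum_{k=1}^n e^{i\langle t,Y^k\rangle+i\langle s,Z^k\rangle}$, $\frac1n\sum_{k=1}^n e^{i\langle t,Y^k\rangle}$ and $\frac1n\sum_{k=1}^n e^{i\langle s,Z^k\rangle}$. (If $b=0$, both quantities are $0$.) Write $X_{c^+}=(X_{c+1},\dots,X_d)$ and $X_{-c}=(X_1,\dots,X_{c-1},X_{c+1},\dots,X_d)$, and likewise for the sample, and define $$\mathcal{R}(X)=\sum_{c=1}^{d-1}\mathcal{V}^2((X_c,X_{c^+})),\qquad \mathcal{S}(X)=\sum_{c=1}^{d}\mathcal{V}^2((X_c,X_{-c})),$$ $$\mathcal{R}_n(\mathbf{X})=\sum_{c=1}^{d-1}\mathcal{V}_n^2((\mathbf{X}_c,\mathbf{X}_{c^+})),\qquad \mathcal{S}_n(\mathbf{X})=\sum_{c=1}^{d}\mathcal{V}_n^2((\mathbf{X}_c,\mathbf{X}_{-c})).$$ If $\mathrm{E}|X|<\infty$, then $\mathcal{R}(X)$ and $\mathcal{S}(X)$ are finite and, as $n\to\infty$, $$\mathcal{R}_n(\mathbf{X})\to\mathcal{R}(X)\quad\text{and}\quad\mathcal{S}_n(\mathbf{X})\to\mathcal{S}(X)\qquad\text{almost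 surely.}$$ -/

import Mathlib

noncomputable section

namespace MutualDependence

open MeasureTheory
open scoped ENNReal InnerProductSpace

/-- The constant `K(q, m) = 2 π^{q/2} Γ(1 - m/2) / (m 2^m Γ((q + m)/2))`. -/
def weightConst (q : ℕ) (m : ℝ) : ℝ :=
  2 * Real.pi ^ ((q : ℝ) / 2) * Real.Gamma (1 - m / 2) /
    (m * (2 : ℝ) ^ m * Real.Gamma (((q : ℝ) + m) / 2))

section DistanceCovariance

variable {ι κ : Type*} [Fintype ι] [Fintype κ]

/-- The weight `w₀(t, s) = (K_p K_q |t|^{p+1} |s|^{q+1})⁻¹` for `t ∈ ℝ^p`, `s ∈ ℝ^q`, where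
`p`, `q` are the cardinalities of the index types `ι`, `κ` and `K_r = K(r, 1)`. -/
def weight (t : EuclideanSpace ℝ ι) (s : EuclideanSpace ℝ κ) : ℝ :=
  (weightConst (Fintype.card ι) 1 * weightConst (Fintype.card κ) 1 *
    ‖t‖ ^ (Fintype.card ι + 1) * ‖s‖ ^ (Fintype.card κ + 1))⁻¹

/-- The squared weighted `L²` norm `∫ |η(t, s)|² w₀(t, s) d(t, s)` with respect to Lebesgue measure
on `ℝ^p × ℝ^q`, as an extended nonnegative real (so that it always exists). -/
def weightedSqNorm (η : EuclideanSpace ℝ ι → EuclideanSpace ℝ κ → ℂ) : ℝ≥0∞ :=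
  ∫⁻ u : EuclideanSpace ℝ ι × EuclideanSpace ℝ κ,
    ENNReal.ofReal (‖η u.1 u.2‖ ^ 2 * weight u.1 u.2)

/-- The characteristic function `E[exp(i⟨t, X⟩)]` of a random vector `X`. -/
def charFn {Ω : Type*} [MeasurableSpace Ω] (P : Measure Ω) (X : Ω → EuclideanSpace ℝ ι)
    (t : EuclideanSpace ℝ ι) : ℂ :=
  ∫ ω, Complex.exp (Complex.I * ((⟪t, X ω⟫_ℝ : ℝ) : ℂ)) ∂P

/-- The characteristic function of the concatenation `(X, Y)` at `(t, s)`, that is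
`E[exp(i(⟨t, X⟩ + ⟨s, Y⟩))]`. -/
def jointCharFn {Ω : Type*} [MeasurableSpace Ω] (P : Measure Ω) (X : Ω → EuclideanSpace ℝ ι)
    (Y : Ω → EuclideanSpace ℝ κ) (t : EuclideanSpace ℝ ι) (s : EuclideanSpace ℝ κ) : ℂ :=
  ∫ ω, Complex.exp (Complex.I * ((⟪t, X ω⟫_ℝ + ⟪s, Y ω⟫_ℝ : ℝ) : ℂ)) ∂P

/-- The squared distance covariance `𝒱²((X, Y))` of two random vectors. -/
def distCovSq {Ω : Type*} [MeasurableSpace Ω] (P : Measure Ω) (X : Ω → EuclideanSpace ℝ ι)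
    (Y : Ω → EuclideanSpace ℝ κ) : ℝ≥0∞ :=
  weightedSqNorm fun t s => jointCharFn P X Y t s - charFn P X t * charFn P Y s

/-- The empirical characteristic function `(1/n) ∑ exp(i⟨t, x^k⟩)` of the first `n` terms of the
sequence `x` (the `n` sample points are indexed by `0, …, n - 1`). -/
def empCharFn (n : ℕ) (x : ℕ → EuclideanSpace ℝ ι) (t : EuclideanSpace ℝ ι) : ℂ :=
  1 / (n : ℂ) * ∑ k ∈ Finset.range n, Complex.exp (Complex.I * ((⟪t, x k⟫_ℝ : ℝ) : ℂ))

/-- The empirical characteristic function of the concatenated sample `(x^k, y^k)` at `(t, s)`. -/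
def empJointCharFn (n : ℕ) (x : ℕ → EuclideanSpace ℝ ι) (y : ℕ → EuclideanSpace ℝ κ)
    (t : EuclideanSpace ℝ ι) (s : EuclideanSpace ℝ κ) : ℂ :=
  1 / (n : ℂ) * ∑ k ∈ Finset.range n,
    Complex.exp (Complex.I * ((⟪t, x k⟫_ℝ + ⟪s, y k⟫_ℝ : ℝ) : ℂ))

/-- The squared empirical distance covariance `𝒱ₙ²((𝐱, 𝐲))` of the first `n` sample points. -/
def empDistCovSq (n : ℕ) (x : ℕ → EuclideanSpace ℝ ι) (y : ℕ → EuclideanSpace ℝ κ) : ℝ≥0∞ :=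
  weightedSqNorm fun t s => empJointCharFn n x y t s - empCharFn n x t * empCharFn n y s

end DistanceCovariance

section Components

variable {d : ℕ} {p : Fin d → ℕ}

/-- The space `ℝ^{p₁ + ⋯ + p_d}`; the coordinate `⟨j, a⟩` is the `a`-th coordinate of the `j`-th
component. It carries the Euclidean norm. -/
abbrev Vec (p : Fin d → ℕ) : Type := EuclideanSpace ℝ ((j : Fin d) × Fin (p j))

/-- The component `x_c ∈ ℝ^{p_c}`. -/
def comp (c : Fin d) (x : Vec p) : EuclideanSpace ℝ (Fin (p c)) :=
  WithLp.toLp 2 fun a => x ⟨c, a⟩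

/-- The vector made of the components `x_j`, `j ∈ s`. -/
def subvec (s : Finset (Fin d)) (x : Vec p) :
    EuclideanSpace ℝ ((j : {j : Fin d // j ∈ s}) × Fin (p j)) :=
  WithLp.toLp 2 fun i => x ⟨i.1, i.2⟩

/-- The asymmetric measure `ℛ(X)`, the sum over `c = 1, …, d - 1` of `𝒱²((X_c, X_{c⁺}))` with
`X_{c⁺} = (X_{c+1}, …, X_d)`; the index `c : Fin d` is zero-based and the last one is left out. -/
def asymMeasure {Ω : Type*} [MeasurableSpace Ω] (P : Measure Ω) (X : Ω → Vec p) : ℝ≥0∞ :=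
  ∑ c ∈ Finset.univ.filter (fun c : Fin d => (c : ℕ) + 1 < d),
    distCovSq P (fun ω => comp c (X ω)) (fun ω => subvec (Finset.Ioi c) (X ω))

/-- The symmetric measure `𝒮(X)`, the sum over all `c` of `𝒱²((X_c, X_{-c}))`, where `X_{-c}`
consists of all components except `X_c`. -/
def symMeasure {Ω : Type*} [MeasurableSpace Ω] (P : Measure Ω) (X : Ω → Vec p) : ℝ≥0∞ :=
  ∑ c : Fin d, distCovSq P (fun ω => comp c (X ω)) (fun ω => subvec (Finset.univ.erase c) (X ω))

/-- The empirical asymmetric measure `ℛₙ` of the first `n` sample points. -/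
def empAsymMeasure (n : ℕ) (x : ℕ → Vec p) : ℝ≥0∞ :=
  ∑ c ∈ Finset.univ.filter (fun c : Fin d => (c : ℕ) + 1 < d),
    empDistCovSq n (fun k => comp c (x k)) (fun k => subvec (Finset.Ioi c) (x k))

/-- The empirical symmetric measure `𝒮ₙ` of the first `n` sample points. -/
def empSymMeasure (n : ℕ) (x : ℕ → Vec p) : ℝ≥0∞ :=
  ∑ c : Fin d, empDistCovSq n (fun k => comp c (x k)) (fun k => subvec (Finset.univ.erase c) (x k))

end Components

end MutualDependence

end

/-! The weight is a product, so a distance covariance is a squared norm in L²(μ ⊗ ν), where μ and ν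
have densities proportional to |t|^{-(p+1)} and |s|^{-(q+1)}. The exponential e^{i⟨t,x⟩} is not
square integrable for μ in positive dimension, but `feature x` = e^{i⟨t,x⟩} - 1 is, and a covariance
does not change when constants are subtracted (`charFnDefect_eq`). Hence 𝒱² is the squared norm of
`covFeature`, the mean of the tensor product of two features minus the tensor product of their means
(`weightedSqNorm_charFnDefect`). The empirical version is the same functional of the empirical
measure.

`covFeature` is continuous in three Bochner means, and each empirical mean converges almost surely
by the strong law in a Banach space. A first moment suffices because ‖feature x‖² ≤ C|x|
(`exists_lintegral_exp_sub_one_le`), so the tensor product of two features grows only linearly. -/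

noncomputable section

namespace MutualDependence

open MeasureTheory
open scoped ENNReal InnerProductSpace

/-! ### The weight as a product measure, and the basic integral estimate -/

section WeightMeasure

variable {ι κ : Type*} [Fintype ι] [Fintype κ]

lemma weightConst_one_pos (q : ℕ) : 0 < weightConst q 1 := by
  unfold weightConst
  have h1 : 0 < Real.Gamma (1 - 1 / 2) := Real.Gamma_pos_of_pos (by norm_num)
  have h2 : 0 < Real.Gamma (((q : ℝ) + 1) / 2) := Real.Gamma_pos_of_pos (by positivity)
  have := Real.pi_pos
  positivity

/-- The measure on `ℝ^p` with density `(K_p |t|^{p+1})⁻¹`. -/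
def weightMeasure (ι : Type*) [Fintype ι] : Measure (EuclideanSpace ℝ ι) :=
  volume.withDensity fun t =>
    ENNReal.ofReal ((weightConst (Fintype.card ι) 1 * ‖t‖ ^ (Fintype.card ι + 1))⁻¹)

lemma measurable_weightMeasure_density (ι : Type*) [Fintype ι] :
    Measurable fun t : EuclideanSpace ℝ ι =>
      ENNReal.ofReal ((weightConst (Fintype.card ι) 1 * ‖t‖ ^ (Fintype.card ι + 1))⁻¹) := by
  fun_prop

instance : SigmaFinite (weightMeasure ι) := by
  unfold weightMeasure
  exact SigmaFinite.withDensity_of_ne_top' fun _ => ENNReal.ofReal_ne_top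

lemma weightedSqNorm_eq (η : EuclideanSpace ℝ ι → EuclideanSpace ℝ κ → ℂ)
    (hη : Measurable (Function.uncurry η)) :
    weightedSqNorm η =
      ∫⁻ u, ‖η u.1 u.2‖ₑ ^ 2 ∂((weightMeasure ι).prod (weightMeasure κ)) := by
  have hm : Measurable fun u : EuclideanSpace ℝ ι × EuclideanSpace ℝ κ => ‖η u.1 u.2‖ₑ ^ 2 :=
    hη.enorm.pow_const 2
  have h1 := measurable_weightMeasure_density ι
  have h2 := measurable_weightMeasure_density κ
  unfold weightedSqNorm weightMeasure
  rw [prod_withDensity h1 h2, lintegral_withDensity_eq_lintegral_mul _ (by fun_prop) hm, ← Measure.volume_eq_prod]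
  refine lintegral_congr fun u => ?_
  simp only [Pi.mul_apply]
  have hp := weightConst_one_pos (Fintype.card ι)
  have hq := weightConst_one_pos (Fintype.card κ)
  rw [← ENNReal.ofReal_mul (by positivity), ← ofReal_norm,
    ← ENNReal.ofReal_pow (norm_nonneg _), ← ENNReal.ofReal_mul (by positivity)]
  congr 1
  unfold weight
  rw [← mul_inv, mul_comm]
  congr 2
  ring

/-- The left side u satisfies u ≤ x² and u ≤ 4, hence u(1 + x²) ≤ 5x². The bound is increasing in x²
and integrates to an arctangent. -/
lemma norm_exp_I_mul_sub_one_sq_le (x : ℝ) :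
    ‖Complex.exp (Complex.I * (x : ℂ)) - 1‖ ^ 2 ≤ 5 * x ^ 2 / (1 + x ^ 2) := by
  have h1 : ‖Complex.exp (Complex.I * (x : ℂ)) - 1‖ ^ 2 ≤ x ^ 2 := by
    rw [← sq_abs x, ← Real.norm_eq_abs]
    exact pow_le_pow_left₀ (norm_nonneg _) Real.norm_exp_I_mul_ofReal_sub_one_le 2
  have h2 : ‖Complex.exp (Complex.I * (x : ℂ)) - 1‖ ^ 2 ≤ 2 ^ 2 := by
    refine pow_le_pow_left₀ (norm_nonneg _) ?_ 2
    refine (norm_sub_le _ _).trans ?_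
    rw [mul_comm, Complex.norm_exp_ofReal_mul_I, norm_one]
    norm_num
  rw [le_div_iff₀ (by positivity)]
  nlinarith [mul_le_mul_of_nonneg_right h2 (sq_nonneg x)]

lemma div_one_add_le {a b : ℝ} (ha : 0 ≤ a) (hab : a ≤ b) :
    5 * a / (1 + a) ≤ 5 * b / (1 + b) := by
  rw [div_le_div_iff₀ (by linarith) (by linarith)]
  nlinarith

/-- Cauchy–Schwarz replaces ⟨t, z⟩ by |t||z|, which leaves a radial integrand. In polar coordinates
the powers of r cancel, and c²/(1 + (rc)²) with c = |z| integrates over r > 0 to cπ/2, linear in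
|z|. -/
lemma exists_lintegral_exp_sub_one_le (ι : Type*) [Fintype ι] :
    ∃ C : ℝ, 0 ≤ C ∧ ∀ z : EuclideanSpace ℝ ι,
      ∫⁻ t, ‖Complex.exp (Complex.I * ((⟪t, z⟫_ℝ : ℝ) : ℂ)) - 1‖ₑ ^ 2 ∂(weightMeasure ι)
        ≤ ENNReal.ofReal (C * ‖z‖) := by
  rcases isEmpty_or_nonempty ι with hι | hι
  · refine ⟨0, le_rfl, fun z => ?_⟩
    have : z = 0 := Subsingleton.elim _ _
    simp [this]
  set K := weightConst (Fintype.card ι) 1 with hK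
  have hKpos : 0 < K := weightConst_one_pos _
  set V : ℝ := (volume : Measure (EuclideanSpace ℝ ι)).real (Metric.ball 0 1)
  set N := Fintype.card ι with hN
  have hNpos : 0 < N := Fintype.card_pos
  -- `N * V` is the area of the unit sphere, 5 comes from the pointwise bound and π/2 from the
  -- arctangent.
  refine ⟨N * (V * (K⁻¹ * (5 * (Real.pi / 2)))), ?_, fun z => ?_⟩
  · have := Real.pi_pos
    positivity
  rcases eq_or_ne z 0 with rfl | hz
  · simp
  set c := ‖z‖ with hc
  have hcpos : 0 < c := norm_pos_iff.2 hz
  let g : ℝ → ℝ := fun r => 5 * (r * c) ^ 2 / (1 + (r * c) ^ 2) * (K * r ^ (N + 1))⁻¹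
  have hg : ∀ r ∈ Set.Ioi (0 : ℝ), r ^ (N - 1) • g r
      = (K⁻¹ * 5 * c ^ 2) * (1 + (r * c) ^ 2)⁻¹ := by
    intro r hr
    have hr : 0 < r := hr
    simp only [g, smul_eq_mul]
    have : r ^ (N + 1) = r ^ (N - 1) * r ^ 2 := by
      rw [← pow_add]; congr 1; omega
    rw [this]
    field_simp
  have hint1 : IntegrableOn (fun r : ℝ => (1 + (r * c) ^ 2)⁻¹) (Set.Ioi 0) :=
    (integrable_inv_one_add_sq.comp_mul_right' hcpos.ne').integrableOn
  have hfin : Module.finrank ℝ (EuclideanSpace ℝ ι) = N := by simp [hN]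
  have hint : Integrable (fun t : EuclideanSpace ℝ ι => g ‖t‖) := by
    rw [integrable_fun_norm_addHaar volume (f := g), hfin]
    exact (integrableOn_congr_fun hg measurableSet_Ioi).2 (hint1.const_mul _)
  have hval : ∫ t : EuclideanSpace ℝ ι, g ‖t‖ = N * (V * (K⁻¹ * (5 * (Real.pi / 2)))) * c := by
    rw [integral_fun_norm_addHaar volume g, hfin, setIntegral_congr_fun measurableSet_Ioi hg,
      integral_const_mul, integral_comp_mul_right_Ioi (fun x => (1 + x ^ 2)⁻¹) 0 hcpos, zero_mul,
      integral_Ioi_inv_one_add_sq]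
    simp only [nsmul_eq_mul, smul_eq_mul, Real.arctan_zero, sub_zero]
    field_simp
    rfl
  have hg0 : ∀ t : EuclideanSpace ℝ ι, 0 ≤ g ‖t‖ := fun t => by
    simp only [g]; positivity
  rw [← hval, ofReal_integral_eq_lintegral_ofReal hint (Filter.Eventually.of_forall hg0)]
  unfold weightMeasure
  rw [lintegral_withDensity_eq_lintegral_mul _ (measurable_weightMeasure_density ι)
    (by fun_prop)]
  refine lintegral_mono fun t => ?_
  simp only [Pi.mul_apply]
  rw [mul_comm, ← ofReal_norm, ← ENNReal.ofReal_pow (norm_nonneg _),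
    ← ENNReal.ofReal_mul (by positivity)]
  refine ENNReal.ofReal_le_ofReal ?_
  refine mul_le_mul_of_nonneg_right ((norm_exp_I_mul_sub_one_sq_le _).trans
    (div_one_add_le (sq_nonneg _) ?_)) (by positivity)
  rw [← sq_abs (inner ℝ t z)]
  exact pow_le_pow_left₀ (abs_nonneg _) (abs_real_inner_le_norm t z) 2

end WeightMeasure

/-! ### Tensor products and Bochner integrals in L² -/

section L2

variable {S R : Type*} [MeasurableSpace S] [MeasurableSpace R]

lemma eLpNorm_two_sq {μ : Measure S} (f : S → ℂ) :
    eLpNorm f 2 μ ^ 2 = ∫⁻ s, ‖f s‖ₑ ^ 2 ∂μ := by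
  have := eLpNorm_nnreal_pow_eq_lintegral (f := f) (μ := μ) (p := 2) (by norm_num)
  simpa using this

lemma eLpNorm_mul_prod {μ : Measure S} {ν : Measure R} [SFinite ν] {f : S → ℂ}
    {g : R → ℂ} (hf : AEStronglyMeasurable f μ) (hg : AEStronglyMeasurable g ν) :
    eLpNorm (fun z : S × R => f z.1 * g z.2) 2 (μ.prod ν) = eLpNorm f 2 μ * eLpNorm g 2 ν := by
  refine (ENNReal.pow_right_strictMono two_ne_zero).injective ?_
  rw [mul_pow, eLpNorm_two_sq, eLpNorm_two_sq, eLpNorm_two_sq]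
  simp_rw [enorm_mul, mul_pow]
  exact lintegral_prod_mul (hf.enorm.pow_const 2) (hg.enorm.pow_const 2)

lemma memLp_mul_prod {μ : Measure S} {ν : Measure R} [SFinite μ] [SFinite ν] {f : S → ℂ}
    {g : R → ℂ} (hf : MemLp f 2 μ) (hg : MemLp g 2 ν) :
    MemLp (fun z : S × R => f z.1 * g z.2) 2 (μ.prod ν) := by
  refine ⟨hf.1.comp_fst.mul hg.1.comp_snd, ?_⟩
  rw [eLpNorm_mul_prod hf.1 hg.1]
  exact ENNReal.mul_lt_top hf.2 hg.2

/-- The tensor product `f ⊗ g` of square integrable functions, as a bounded bilinear map. -/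
def tensorL2 (μ : Measure S) (ν : Measure R) [SFinite μ] [SFinite ν] :
    Lp ℂ 2 μ →L[ℝ] Lp ℂ 2 ν →L[ℝ] Lp ℂ 2 (μ.prod ν) :=
  LinearMap.mkContinuous₂
    (LinearMap.mk₂ ℝ (fun f g => (memLp_mul_prod (Lp.memLp f) (Lp.memLp g)).toLp)
      (fun f f' g => by
        rw [← MemLp.toLp_add]
        refine MemLp.toLp_congr _ _ ?_
        filter_upwards [Measure.quasiMeasurePreserving_fst.ae (Lp.coeFn_add f f')] with z hz
        change (f + f' : Lp ℂ 2 μ) z.1 * g z.2 = _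
        rw [hz]
        exact add_mul _ _ _)
      (fun c f g => by
        rw [← MemLp.toLp_const_smul]
        refine MemLp.toLp_congr _ _ ?_
        filter_upwards [Measure.quasiMeasurePreserving_fst.ae (Lp.coeFn_smul c f)] with z hz
        change (c • f : Lp ℂ 2 μ) z.1 * g z.2 = _
        rw [hz]
        simp only [Pi.smul_apply, smul_mul_assoc])
      (fun f g g' => by
        rw [← MemLp.toLp_add]
        refine MemLp.toLp_congr _ _ ?_
        filter_upwards [Measure.quasiMeasurePreserving_snd.ae (Lp.coeFn_add g g')] with z hz
        change f z.1 * (g + g' : Lp ℂ 2 ν) z.2 = _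
        rw [hz]
        exact mul_add _ _ _)
      (fun c f g => by
        rw [← MemLp.toLp_const_smul]
        refine MemLp.toLp_congr _ _ ?_
        filter_upwards [Measure.quasiMeasurePreserving_snd.ae (Lp.coeFn_smul c g)] with z hz
        change f z.1 * (c • g : Lp ℂ 2 ν) z.2 = _
        rw [hz]
        simp only [Pi.smul_apply, mul_smul_comm]))
    1 (fun f g => by
      simp only [LinearMap.mk₂_apply, Lp.norm_toLp, one_mul]
      rw [eLpNorm_mul_prod (Lp.memLp f).1 (Lp.memLp g).1, ENNReal.toReal_mul, Lp.norm_def,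
        Lp.norm_def])

lemma coeFn_tensorL2 {μ : Measure S} {ν : Measure R} [SFinite μ] [SFinite ν] (f : Lp ℂ 2 μ)
    (g : Lp ℂ 2 ν) {f' : S → ℂ} {g' : R → ℂ} (hf : f =ᵐ[μ] f') (hg : g =ᵐ[ν] g') :
    tensorL2 μ ν f g =ᵐ[μ.prod ν] fun z => f' z.1 * g' z.2 := by
  have h := (memLp_mul_prod (Lp.memLp f) (Lp.memLp g)).coeFn_toLp
  filter_upwards [h, Measure.quasiMeasurePreserving_fst.ae hf,
    Measure.quasiMeasurePreserving_snd.ae hg] with z hz h1 h2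
  refine hz.trans ?_
  rw [h1, h2]

lemma norm_tensorL2_le {μ : Measure S} {ν : Measure R} [SFinite μ] [SFinite ν] (f : Lp ℂ 2 μ)
    (g : Lp ℂ 2 ν) : ‖tensorL2 μ ν f g‖ ≤ ‖f‖ * ‖g‖ := by
  refine (ContinuousLinearMap.le_of_opNorm₂_le_of_le _
    (LinearMap.mkContinuous₂_norm_le _ zero_le_one _) le_rfl le_rfl).trans_eq (by ring)

/-- The Bochner integral of an `L²`-valued function is the pointwise integral. -/
lemma coeFn_integral_Lp {ν : Measure S} [SigmaFinite ν] {Q : Measure R} [IsFiniteMeasure Q]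
    {f : R → Lp ℂ 2 ν} {F : R → S → ℂ} (hf : Integrable f Q)
    (hF : StronglyMeasurable (Function.uncurry F)) {C : ℝ} (hC : ∀ r s, ‖F r s‖ ≤ C)
    (hfF : ∀ r, f r =ᵐ[ν] F r) :
    (∫ r, f r ∂Q : Lp ℂ 2 ν) =ᵐ[ν] fun s => ∫ r, F r s ∂Q := by
  have hm : StronglyMeasurable fun s => ∫ r, F r s ∂Q :=
    (hF.comp_measurable measurable_swap).integral_prod_right'
  have hb : ∀ s, ‖∫ r, F r s ∂Q‖ ≤ C * Q.real Set.univ := fun s =>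
    norm_integral_le_of_norm_le_const (Filter.Eventually.of_forall fun r => hC r s)
  -- It is enough to compare integrals over sets of finite measure. There the integral is the inner
  -- product with an indicator, which commutes with the Bochner integral; the uniform bound then
  -- permits Fubini.
  refine ae_eq_of_forall_setIntegral_eq_of_sigmaFinite
    (fun s hs hνs => ?_) (fun s hs hνs => ?_) (fun s hs hνs => ?_)
  · exact integrableOn_Lp_of_measure_ne_top _ (by norm_num) hνs.ne
  · exact Measure.integrableOn_of_bounded hνs.ne hm.aestronglyMeasurable
      (Filter.Eventually.of_forall hb)
  · have : IsFiniteMeasure (ν.restrict s) := ⟨by simpa using hνs⟩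
    rw [← L2.inner_indicatorConstLp_one (𝕜 := ℂ) hs hνs.ne, ← integral_inner hf]
    simp_rw [L2.inner_indicatorConstLp_one (𝕜 := ℂ) hs hνs.ne]
    rw [integral_congr_ae (g := fun r => ∫ t in s, F r t ∂ν) (Filter.Eventually.of_forall
      fun r => integral_congr_ae (ae_restrict_of_ae (hfF r)))]
    exact integral_integral_swap (Integrable.of_bound hF.aestronglyMeasurable C
      (Filter.Eventually.of_forall fun z => hC z.1 z.2))

end L2

/-! ### The feature map and the covariance element -/

section Feature

variable {ι κ : Type*} [Fintype ι] [Fintype κ]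

lemma memLp_exp_sub_one (x : EuclideanSpace ℝ ι) :
    MemLp (fun t : EuclideanSpace ℝ ι => Complex.exp (Complex.I * ((⟪t, x⟫_ℝ : ℝ) : ℂ)) - 1) 2
      (weightMeasure ι) := by
  obtain ⟨C, -, hC⟩ := exists_lintegral_exp_sub_one_le ι
  refine ⟨Continuous.aestronglyMeasurable (by fun_prop), ?_⟩
  have h := (hC x).trans_lt ENNReal.ofReal_lt_top
  rw [← eLpNorm_two_sq, ENNReal.pow_lt_top_iff] at h
  exact h.resolve_right two_ne_zero

/-- The function `t ↦ exp(i⟨t, x⟩) - 1` as an element of the weighted `L²` space. -/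
def feature (x : EuclideanSpace ℝ ι) : Lp ℂ 2 (weightMeasure ι) :=
  (memLp_exp_sub_one x).toLp

lemma coeFn_feature (x : EuclideanSpace ℝ ι) :
    feature x =ᵐ[weightMeasure ι]
      fun t => Complex.exp (Complex.I * ((⟪t, x⟫_ℝ : ℝ) : ℂ)) - 1 :=
  MemLp.coeFn_toLp _

/-- The unimodular factor e^{i⟨t,y⟩} can be pulled out of the difference. Continuity of `feature`
thus reduces to the growth bound near the origin. -/
lemma norm_feature_sub (x y : EuclideanSpace ℝ ι) :
    ‖feature x - feature y‖ = ‖feature (x - y)‖ := by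
  unfold feature
  rw [← MemLp.toLp_sub, Lp.norm_toLp, Lp.norm_toLp]
  congr 1
  refine eLpNorm_congr_norm_ae (Filter.Eventually.of_forall fun t => ?_)
  have h : Complex.exp (Complex.I * ((⟪t, x⟫_ℝ : ℝ) : ℂ)) - 1
      - (Complex.exp (Complex.I * ((⟪t, y⟫_ℝ : ℝ) : ℂ)) - 1)
      = Complex.exp (Complex.I * ((⟪t, y⟫_ℝ : ℝ) : ℂ)) *
        (Complex.exp (Complex.I * ((⟪t, x - y⟫_ℝ : ℝ) : ℂ)) - 1) := by
    rw [mul_sub, ← Complex.exp_add, inner_sub_right]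
    push_cast
    ring_nf
  simp only [Pi.sub_apply]
  rw [h, norm_mul, mul_comm Complex.I, Complex.norm_exp_ofReal_mul_I, one_mul]

lemma exists_norm_feature_le (ι : Type*) [Fintype ι] :
    ∃ C : ℝ, 0 ≤ C ∧ ∀ x : EuclideanSpace ℝ ι, ‖feature x‖ ≤ √(C * ‖x‖) := by
  obtain ⟨C, hC0, hC⟩ := exists_lintegral_exp_sub_one_le ι
  refine ⟨C, hC0, fun x => Real.le_sqrt_of_sq_le ?_⟩
  unfold feature
  rw [Lp.norm_toLp, ← ENNReal.toReal_pow, eLpNorm_two_sq]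
  exact ENNReal.toReal_le_of_le_ofReal (by positivity) (hC x)

lemma continuous_feature : Continuous (feature : EuclideanSpace ℝ ι → _) := by
  obtain ⟨C, hC0, hC⟩ := exists_norm_feature_le ι
  refine continuous_iff_continuousAt.2 fun x => ?_
  rw [ContinuousAt, tendsto_iff_norm_sub_tendsto_zero]
  have h : Filter.Tendsto (fun y => √(C * ‖y - x‖)) (nhds x) (nhds 0) := by
    have : Continuous fun y => √(C * ‖y - x‖) := by fun_prop
    simpa using this.tendsto x
  refine squeeze_zero (fun _ => norm_nonneg _) (fun y => ?_) h
  rw [norm_feature_sub]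
  exact hC _

lemma norm_exp_I_inner (t x : EuclideanSpace ℝ ι) :
    ‖Complex.exp (Complex.I * ((⟪t, x⟫_ℝ : ℝ) : ℂ))‖ = 1 := by
  rw [mul_comm, Complex.norm_exp_ofReal_mul_I]

lemma norm_exp_I_inner_sub_one_le (t x : EuclideanSpace ℝ ι) :
    ‖Complex.exp (Complex.I * ((⟪t, x⟫_ℝ : ℝ) : ℂ)) - 1‖ ≤ 2 := by
  refine (norm_sub_le _ _).trans ?_
  rw [norm_exp_I_inner, norm_one]
  norm_num

/-- The product feature `(x, y) ↦ feature x ⊗ feature y`. -/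
def prodFeature (z : EuclideanSpace ℝ ι × EuclideanSpace ℝ κ) :
    Lp ℂ 2 ((weightMeasure ι).prod (weightMeasure κ)) :=
  tensorL2 _ _ (feature z.1) (feature z.2)

lemma continuous_prodFeature :
    Continuous (prodFeature : EuclideanSpace ℝ ι × EuclideanSpace ℝ κ → _) :=
  (tensorL2 _ _).continuous₂.comp
    ((continuous_feature.comp continuous_fst).prodMk (continuous_feature.comp continuous_snd))

variable {Q : Measure (EuclideanSpace ℝ ι × EuclideanSpace ℝ κ)}

/-- The growth is that of a square root, and √u ≤ u + 1. The map `f` stands for either coordinate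
projection. -/
lemma integrable_feature {E : Type*} [NormedAddCommGroup E] [MeasurableSpace E]
    {Q : Measure E} [IsFiniteMeasure Q] (hQ : Integrable (fun z => z) Q)
    {f : E → EuclideanSpace ℝ ι} (hf : Continuous f)
    (hfn : ∀ z, ‖f z‖ ≤ ‖z‖) : Integrable (fun z => feature (f z)) Q := by
  obtain ⟨C, hC0, hC⟩ := exists_norm_feature_le ι
  refine ((hQ.norm.const_mul C).add (integrable_const 1)).mono'
    ((continuous_feature.comp hf).comp_aestronglyMeasurable hQ.1)
    (Filter.Eventually.of_forall fun z => (hC _).trans ?_)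
  refine Real.sqrt_le_iff.2 ⟨by simp only [Pi.add_apply]; positivity, ?_⟩
  simp only [Pi.add_apply]
  have h1 := mul_le_mul_of_nonneg_left (hfn z) hC0
  have h2 : 0 ≤ C * ‖z‖ := by positivity
  nlinarith

/-- The two square-root bounds multiply to a linear one, by √u √v ≤ u + v. -/
lemma integrable_prodFeature (hQ : Integrable (fun z => z) Q) : Integrable prodFeature Q := by
  obtain ⟨C, hC0, hC⟩ := exists_norm_feature_le ι
  obtain ⟨D, hD0, hD⟩ := exists_norm_feature_le κ
  refine (hQ.norm.const_mul (C + D)).mono' (continuous_prodFeature.comp_aestronglyMeasurable hQ.1)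
    (Filter.Eventually.of_forall fun z => (norm_tensorL2_le _ _).trans ?_)
  have h1 : ‖feature z.1‖ ≤ √(C * ‖z‖) := (hC _).trans
    (Real.sqrt_le_sqrt (mul_le_mul_of_nonneg_left (norm_fst_le z) hC0))
  have h2 : ‖feature z.2‖ ≤ √(D * ‖z‖) := (hD _).trans
    (Real.sqrt_le_sqrt (mul_le_mul_of_nonneg_left (norm_snd_le z) hD0))
  refine (mul_le_mul h1 h2 (norm_nonneg _) (Real.sqrt_nonneg _)).trans ?_
  have h3 := Real.sq_sqrt (show 0 ≤ C * ‖z‖ by positivity)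
  have h4 := Real.sq_sqrt (show 0 ≤ D * ‖z‖ by positivity)
  nlinarith [sq_nonneg (√(C * ‖z‖) - √(D * ‖z‖)), Real.sqrt_nonneg (C * ‖z‖),
    Real.sqrt_nonneg (D * ‖z‖)]

/-- The difference between the characteristic function of a law on `ℝ^p × ℝ^q` and the product of
the characteristic functions of its marginals. -/
def charFnDefect (Q : Measure (EuclideanSpace ℝ ι × EuclideanSpace ℝ κ))
    (t : EuclideanSpace ℝ ι) (s : EuclideanSpace ℝ κ) : ℂ :=
  (∫ z, Complex.exp (Complex.I * ((⟪t, z.1⟫_ℝ + ⟪s, z.2⟫_ℝ : ℝ) : ℂ)) ∂Q) -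
    (∫ z, Complex.exp (Complex.I * ((⟪t, z.1⟫_ℝ : ℝ) : ℂ)) ∂Q) *
    ∫ z, Complex.exp (Complex.I * ((⟪s, z.2⟫_ℝ : ℝ) : ℂ)) ∂Q

/-- The covariance element of a law in the tensor product of the weighted `L²` spaces. -/
def covFeature (Q : Measure (EuclideanSpace ℝ ι × EuclideanSpace ℝ κ)) :
    Lp ℂ 2 ((weightMeasure ι).prod (weightMeasure κ)) :=
  (∫ z, prodFeature z ∂Q) - tensorL2 _ _ (∫ z, feature z.1 ∂Q) (∫ z, feature z.2 ∂Q)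

lemma integrable_of_continuous_of_norm_le [IsFiniteMeasure Q]
    {f : EuclideanSpace ℝ ι × EuclideanSpace ℝ κ → ℂ} (hf : Continuous f) {C : ℝ}
    (hC : ∀ z, ‖f z‖ ≤ C) : Integrable f Q :=
  Integrable.of_bound hf.aestronglyMeasurable C (Filter.Eventually.of_forall hC)

/-- Shifting both factors by constants preserves a covariance; total mass one is essential here. -/
lemma charFnDefect_eq [IsProbabilityMeasure Q] (t : EuclideanSpace ℝ ι)
    (s : EuclideanSpace ℝ κ) :
    charFnDefect Q t s =
      (∫ z, (Complex.exp (Complex.I * ((⟪t, z.1⟫_ℝ : ℝ) : ℂ)) - 1) *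
        (Complex.exp (Complex.I * ((⟪s, z.2⟫_ℝ : ℝ) : ℂ)) - 1) ∂Q) -
      (∫ z, (Complex.exp (Complex.I * ((⟪t, z.1⟫_ℝ : ℝ) : ℂ)) - 1) ∂Q) *
        ∫ z, (Complex.exp (Complex.I * ((⟪s, z.2⟫_ℝ : ℝ) : ℂ)) - 1) ∂Q := by
  have ha : Integrable (fun z : EuclideanSpace ℝ ι × EuclideanSpace ℝ κ =>
      Complex.exp (Complex.I * ((⟪t, z.1⟫_ℝ : ℝ) : ℂ))) Q :=
    integrable_of_continuous_of_norm_le (by fun_prop) fun z => (norm_exp_I_inner _ _).le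
  have hb : Integrable (fun z : EuclideanSpace ℝ ι × EuclideanSpace ℝ κ =>
      Complex.exp (Complex.I * ((⟪s, z.2⟫_ℝ : ℝ) : ℂ))) Q :=
    integrable_of_continuous_of_norm_le (by fun_prop) fun z => (norm_exp_I_inner _ _).le
  have hab : Integrable (fun z : EuclideanSpace ℝ ι × EuclideanSpace ℝ κ =>
      Complex.exp (Complex.I * ((⟪t, z.1⟫_ℝ + ⟪s, z.2⟫_ℝ : ℝ) : ℂ))) Q :=
    integrable_of_continuous_of_norm_le (C := 1) (by fun_prop) fun z => by
      rw [mul_comm, Complex.norm_exp_ofReal_mul_I]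
  have h : ∀ z : EuclideanSpace ℝ ι × EuclideanSpace ℝ κ,
      (Complex.exp (Complex.I * ((⟪t, z.1⟫_ℝ : ℝ) : ℂ)) - 1) *
        (Complex.exp (Complex.I * ((⟪s, z.2⟫_ℝ : ℝ) : ℂ)) - 1) =
      Complex.exp (Complex.I * ((⟪t, z.1⟫_ℝ + ⟪s, z.2⟫_ℝ : ℝ) : ℂ)) -
        Complex.exp (Complex.I * ((⟪t, z.1⟫_ℝ : ℝ) : ℂ)) -
        (Complex.exp (Complex.I * ((⟪s, z.2⟫_ℝ : ℝ) : ℂ)) - 1) := fun z => by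
    push_cast
    rw [mul_add, Complex.exp_add]
    ring
  have h1 : ∀ f : EuclideanSpace ℝ ι × EuclideanSpace ℝ κ → ℂ, Integrable f Q →
      ∫ z, (f z - 1) ∂Q = (∫ z, f z ∂Q) - 1 := fun f hf => by
    rw [integral_sub hf (integrable_const 1)]
    simp
  have h2 : ∀ f g k : EuclideanSpace ℝ ι × EuclideanSpace ℝ κ → ℂ, Integrable f Q →
      Integrable g Q → Integrable k Q →
      ∫ z, (f z - g z - (k z - 1)) ∂Q = (∫ z, f z ∂Q) - (∫ z, g z ∂Q) - ((∫ z, k z ∂Q) - 1) :=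
    fun f g k hf hg hk => by
      rw [← h1 k hk, ← integral_sub hf hg]
      exact integral_sub (hf.sub hg) (hk.sub (integrable_const 1))
  rw [integral_congr_ae (Filter.Eventually.of_forall h), h2 _ _ _ hab ha hb, h1 _ ha, h1 _ hb]
  unfold charFnDefect
  ring

lemma coeFn_integral_feature {E : Type*} [NormedAddCommGroup E] [MeasurableSpace E]
    [OpensMeasurableSpace E] [SecondCountableTopology E] {Q : Measure E} [IsFiniteMeasure Q]
    (hQ : Integrable (fun z => z) Q) {f : E → EuclideanSpace ℝ ι} (hf : Continuous f)
    (hfn : ∀ z, ‖f z‖ ≤ ‖z‖) :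
    (∫ z, feature (f z) ∂Q : Lp ℂ 2 (weightMeasure ι)) =ᵐ[weightMeasure ι]
      fun t => ∫ z, (Complex.exp (Complex.I * ((⟪t, f z⟫_ℝ : ℝ) : ℂ)) - 1) ∂Q := by
  have hF : Continuous (Function.uncurry fun (z : E) (t : EuclideanSpace ℝ ι) =>
      Complex.exp (Complex.I * ((⟪t, f z⟫_ℝ : ℝ) : ℂ)) - 1) := by
    unfold Function.uncurry
    fun_prop
  exact coeFn_integral_Lp (integrable_feature hQ hf hfn) hF.stronglyMeasurable
    (fun z t => norm_exp_I_inner_sub_one_le _ _) fun z => coeFn_feature (f z)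

lemma coeFn_prodFeature (z : EuclideanSpace ℝ ι × EuclideanSpace ℝ κ) :
    prodFeature z =ᵐ[(weightMeasure ι).prod (weightMeasure κ)]
      fun u => (Complex.exp (Complex.I * ((⟪u.1, z.1⟫_ℝ : ℝ) : ℂ)) - 1) *
        (Complex.exp (Complex.I * ((⟪u.2, z.2⟫_ℝ : ℝ) : ℂ)) - 1) := by
  have h := coeFn_tensorL2 (feature z.1) (feature z.2)
    (f' := fun t => Complex.exp (Complex.I * ((⟪t, z.1⟫_ℝ : ℝ) : ℂ)) - 1)
    (g' := fun s => Complex.exp (Complex.I * ((⟪s, z.2⟫_ℝ : ℝ) : ℂ)) - 1)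
    (coeFn_feature z.1) (coeFn_feature z.2)
  unfold prodFeature
  exact h

lemma coeFn_integral_prodFeature [IsFiniteMeasure Q] (hQ : Integrable (fun z => z) Q) :
    (∫ z, prodFeature z ∂Q : Lp ℂ 2 ((weightMeasure ι).prod (weightMeasure κ)))
      =ᵐ[(weightMeasure ι).prod (weightMeasure κ)]
      fun u => ∫ z, (Complex.exp (Complex.I * ((⟪u.1, z.1⟫_ℝ : ℝ) : ℂ)) - 1) *
        (Complex.exp (Complex.I * ((⟪u.2, z.2⟫_ℝ : ℝ) : ℂ)) - 1) ∂Q := by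
  have hF : Continuous (Function.uncurry fun (z u : EuclideanSpace ℝ ι × EuclideanSpace ℝ κ) =>
      (Complex.exp (Complex.I * ((⟪u.1, z.1⟫_ℝ : ℝ) : ℂ)) - 1) *
        (Complex.exp (Complex.I * ((⟪u.2, z.2⟫_ℝ : ℝ) : ℂ)) - 1)) := by
    unfold Function.uncurry
    fun_prop
  refine coeFn_integral_Lp (integrable_prodFeature hQ) hF.stronglyMeasurable (C := 2 * 2)
    (fun z t => ?_) coeFn_prodFeature
  rw [norm_mul]
  exact mul_le_mul (norm_exp_I_inner_sub_one_le _ _) (norm_exp_I_inner_sub_one_le _ _)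
    (norm_nonneg _) zero_le_two

lemma coeFn_covFeature [IsProbabilityMeasure Q] (hQ : Integrable (fun z => z) Q) :
    covFeature Q =ᵐ[(weightMeasure ι).prod (weightMeasure κ)]
      fun u => charFnDefect Q u.1 u.2 := by
  have h12 := coeFn_tensorL2 _ _ (coeFn_integral_feature hQ continuous_fst norm_fst_le)
    (coeFn_integral_feature hQ continuous_snd norm_snd_le)
  have h3 := coeFn_integral_prodFeature hQ
  refine (Lp.coeFn_sub _ _).trans ?_
  filter_upwards [h12, h3] with u h12 h3
  rw [Pi.sub_apply, h12, h3, charFnDefect_eq]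

lemma measurable_charFnDefect [IsFiniteMeasure Q] :
    Measurable (Function.uncurry (charFnDefect Q)) := by
  have h : ∀ f : (EuclideanSpace ℝ ι × EuclideanSpace ℝ κ) →
      (EuclideanSpace ℝ ι × EuclideanSpace ℝ κ) → ℂ, Continuous (Function.uncurry f) →
      Measurable fun u => ∫ z, f u z ∂Q := fun f hf =>
    (StronglyMeasurable.integral_prod_right hf.stronglyMeasurable).measurable
  exact (h (fun u z => Complex.exp (Complex.I * ((⟪u.1, z.1⟫_ℝ + ⟪u.2, z.2⟫_ℝ : ℝ) : ℂ)))
      (by unfold Function.uncurry; fun_prop)).sub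
    ((h (fun u z => Complex.exp (Complex.I * ((⟪u.1, z.1⟫_ℝ : ℝ) : ℂ)))
      (by unfold Function.uncurry; fun_prop)).mul
    (h (fun u z => Complex.exp (Complex.I * ((⟪u.2, z.2⟫_ℝ : ℝ) : ℂ)))
      (by unfold Function.uncurry; fun_prop)))

lemma weightedSqNorm_charFnDefect [IsProbabilityMeasure Q] (hQ : Integrable (fun z => z) Q) :
    weightedSqNorm (charFnDefect Q) = ENNReal.ofReal (‖covFeature Q‖ ^ 2) := by
  rw [weightedSqNorm_eq _ measurable_charFnDefect, ENNReal.ofReal_pow (norm_nonneg _),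
    ofReal_norm, Lp.enorm_def, eLpNorm_two_sq]
  refine lintegral_congr_ae ?_
  filter_upwards [coeFn_covFeature hQ] with u hu
  rw [hu]

end Feature

/-! ### Empirical measures and the strong law -/

section Consistency

/-- The empirical measure of the first `n` terms of a sequence. -/
def empMeasure {E : Type*} [MeasurableSpace E] (n : ℕ) (x : ℕ → E) : Measure E :=
  (n : ℝ≥0∞)⁻¹ • ∑ k ∈ Finset.range n, Measure.dirac (x k)

section EmpMeasure

variable {E : Type*} [MeasurableSpace E]

lemma isProbabilityMeasure_empMeasure {n : ℕ} (hn : n ≠ 0) (x : ℕ → E) :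
    IsProbabilityMeasure (empMeasure n x) := by
  refine ⟨?_⟩
  simp only [empMeasure, Measure.smul_apply, Measure.coe_finsetSum, Finset.sum_apply,
    measure_univ, Finset.sum_const, Finset.card_range, nsmul_eq_mul, mul_one, smul_eq_mul]
  exact ENNReal.inv_mul_cancel (by simpa using hn) (ENNReal.natCast_ne_top n)

variable [MeasurableSingletonClass E]

lemma integrable_empMeasure {H : Type*} [NormedAddCommGroup H] {n : ℕ} (hn : n ≠ 0) (x : ℕ → E)
    (f : E → H) : Integrable f (empMeasure n x) := by
  refine Integrable.smul_measure ?_ (by simpa using hn)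
  exact integrable_finsetSum_measure.2 fun k _ => integrable_dirac (by simp)

lemma integral_empMeasure {H : Type*} [NormedAddCommGroup H] [NormedSpace ℝ H] [CompleteSpace H]
    (n : ℕ) (x : ℕ → E) (f : E → H) :
    ∫ z, f z ∂(empMeasure n x) = (n : ℝ)⁻¹ • ∑ k ∈ Finset.range n, f (x k) := by
  rw [empMeasure, integral_smul_measure, integral_finsetSum_measure fun k _ =>
    integrable_dirac (by simp)]
  simp

end EmpMeasure

/-- Strong law of large numbers for the empirical integrals of a continuous function with values
in a Banach space. -/
lemma ae_tendsto_integral_empMeasure {E H : Type*} [NormedAddCommGroup E] [MeasurableSpace E]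
    [BorelSpace E] [NormedAddCommGroup H] [NormedSpace ℝ H] [CompleteSpace H]
    {Ω Ω' : Type*} [MeasurableSpace Ω] [MeasurableSpace Ω'] {P : Measure Ω}
    {P' : Measure Ω'} {Z : Ω' → E} {sample : ℕ → Ω → E}
    (hindep : ProbabilityTheory.iIndepFun sample P)
    (hident : ∀ k, ProbabilityTheory.IdentDistrib (sample k) Z P P')
    {f : E → H} (hf : Continuous f) (hint : Integrable f (P'.map Z)) :
    ∀ᵐ ω ∂P, Filter.Tendsto
      (fun n : ℕ => ∫ z, f z ∂(empMeasure n fun k => sample k ω)) Filter.atTop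
      (nhds (∫ z, f z ∂(P'.map Z))) := by
  borelize H
  have hZ : AEMeasurable Z P' := (hident 0).aemeasurable_snd
  have hid : ∀ k, ProbabilityTheory.IdentDistrib (f ∘ sample k) (f ∘ Z) P P' := fun k =>
    (hident k).comp hf.measurable
  have hintZ : Integrable (f ∘ Z) P' := hint.comp_aemeasurable hZ
  -- This Banach-valued law asks only for pairwise independence.
  have h := ProbabilityTheory.strong_law_ae (μ := P) (fun k => f ∘ sample k)
    ((hid 0).integrable_iff.2 hintZ)
    (fun i j hij => (hindep.indepFun hij).comp hf.measurable hf.measurable)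
    (fun i => (hid i).trans (hid 0).symm)
  have hlim : ∫ ω, (f ∘ sample 0) ω ∂P = ∫ z, f z ∂(P'.map Z) := by
    rw [(hid 0).integral_eq, integral_map hZ hint.1]
    rfl
  rw [← hlim]
  simpa only [integral_empMeasure, Function.comp_apply] using h

variable {ι κ : Type*} [Fintype ι] [Fintype κ]

lemma distCovSq_eq {Ω' : Type*} [MeasurableSpace Ω'] {P' : Measure Ω'}
    {Z : Ω' → EuclideanSpace ℝ ι × EuclideanSpace ℝ κ} (hZ : AEMeasurable Z P') :
    distCovSq P' (fun ω => (Z ω).1) (fun ω => (Z ω).2) =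
      weightedSqNorm (charFnDefect (P'.map Z)) := by
  unfold distCovSq
  congr 1
  funext t s
  unfold charFnDefect jointCharFn charFn
  rw [integral_map hZ (Continuous.aestronglyMeasurable (by fun_prop)),
    integral_map hZ (Continuous.aestronglyMeasurable (by fun_prop)),
    integral_map hZ (Continuous.aestronglyMeasurable (by fun_prop))]

lemma empDistCovSq_eq (n : ℕ) (z : ℕ → EuclideanSpace ℝ ι × EuclideanSpace ℝ κ) :
    empDistCovSq n (fun k => (z k).1) (fun k => (z k).2) =
      weightedSqNorm (charFnDefect (empMeasure n z)) := by
  unfold empDistCovSq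
  congr 1
  funext t s
  unfold charFnDefect empJointCharFn empCharFn
  simp only [integral_empMeasure, Complex.real_smul, one_div, Complex.ofReal_inv,
    Complex.ofReal_natCast]

lemma distCovSq_lt_top_and_ae_tendsto
    {Ω Ω' : Type*} [MeasurableSpace Ω] [MeasurableSpace Ω'] {P : Measure Ω}
    {P' : Measure Ω'} [IsProbabilityMeasure P']
    {Z : Ω' → EuclideanSpace ℝ ι × EuclideanSpace ℝ κ}
    {sample : ℕ → Ω → EuclideanSpace ℝ ι × EuclideanSpace ℝ κ}
    (hindep : ProbabilityTheory.iIndepFun sample P)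
    (hident : ∀ k, ProbabilityTheory.IdentDistrib (sample k) Z P P')
    (hZ : Integrable Z P') :
    distCovSq P' (fun ω => (Z ω).1) (fun ω => (Z ω).2) < ⊤ ∧
    ∀ᵐ ω ∂P, Filter.Tendsto
      (fun n : ℕ => empDistCovSq n (fun k => (sample k ω).1) (fun k => (sample k ω).2))
      Filter.atTop (nhds (distCovSq P' (fun ω => (Z ω).1) (fun ω => (Z ω).2))) := by
  have hZm : AEMeasurable Z P' := (hident 0).aemeasurable_snd
  have : IsProbabilityMeasure (P'.map Z) := Measure.isProbabilityMeasure_map hZm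
  have hQ : Integrable (fun z => z) (P'.map Z) :=
    (integrable_map_measure aestronglyMeasurable_id hZm).2 hZ
  rw [distCovSq_eq hZm, weightedSqNorm_charFnDefect hQ]
  refine ⟨ENNReal.ofReal_lt_top, ?_⟩
  filter_upwards [
    ae_tendsto_integral_empMeasure hindep hident (continuous_feature.comp continuous_fst)
      (integrable_feature hQ continuous_fst norm_fst_le),
    ae_tendsto_integral_empMeasure hindep hident (continuous_feature.comp continuous_snd)
      (integrable_feature hQ continuous_snd norm_snd_le),
    ae_tendsto_integral_empMeasure hindep hident continuous_prodFeature
      (integrable_prodFeature hQ)] with ω h1 h2 h3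
  -- Joint continuity of the tensor product carries the limits of the two marginal means to their
  -- product.
  have h12 := ((tensorL2 (weightMeasure ι) (weightMeasure κ)).continuous₂.tendsto _).comp
    (h1.prodMk_nhds h2)
  have h : Filter.Tendsto (fun n : ℕ => covFeature (empMeasure n fun k => sample k ω))
      Filter.atTop (nhds (covFeature (P'.map Z))) := h3.sub h12
  refine Filter.Tendsto.congr' ?_ (ENNReal.tendsto_ofReal (h.norm.pow 2))
  -- For n = 0 the empirical measure is zero, not a probability measure.
  filter_upwards [Filter.eventually_ne_atTop 0] with n hn
  have := isProbabilityMeasure_empMeasure hn fun k => sample k ω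
  rw [empDistCovSq_eq, weightedSqNorm_charFnDefect (integrable_empMeasure hn _ _)]

/-! ### Components of the vector, and the finite sums -/

variable {d : ℕ} {p : Fin d → ℕ}

lemma continuous_comp (c : Fin d) : Continuous (comp c : Vec p → _) := by
  unfold comp
  fun_prop

lemma continuous_subvec (s : Finset (Fin d)) : Continuous (subvec s : Vec p → _) := by
  unfold subvec
  fun_prop

lemma norm_comp_le (c : Fin d) (x : Vec p) : ‖comp c x‖ ≤ ‖x‖ := by
  rw [EuclideanSpace.norm_eq, EuclideanSpace.norm_eq]
  refine Real.sqrt_le_sqrt ?_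
  rw [Fintype.sum_sigma]
  exact Finset.single_le_sum (f := fun j => ∑ a, ‖x ⟨j, a⟩‖ ^ 2)
    (fun j _ => Finset.sum_nonneg fun a _ => sq_nonneg _) (Finset.mem_univ c)

lemma norm_subvec_le (s : Finset (Fin d)) (x : Vec p) : ‖subvec s x‖ ≤ ‖x‖ := by
  rw [EuclideanSpace.norm_eq, EuclideanSpace.norm_eq]
  refine Real.sqrt_le_sqrt ?_
  rw [Fintype.sum_sigma, Fintype.sum_sigma]
  change ∑ j : {j // j ∈ s}, ∑ a, ‖x ⟨j, a⟩‖ ^ 2 ≤ _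
  rw [Finset.sum_coe_sort s fun j => ∑ a, ‖x ⟨j, a⟩‖ ^ 2]
  exact Finset.sum_le_univ_sum_of_nonneg fun j => Finset.sum_nonneg fun a _ => sq_nonneg _

/-- Leaving `u` and `s` free treats ℛ and 𝒮 at once. Finitely many almost sure events hold
simultaneously. -/
lemma sum_distCovSq_lt_top_and_ae_tendsto
    {Ω Ω' : Type*} [MeasurableSpace Ω] [MeasurableSpace Ω'] {P : Measure Ω}
    {P' : Measure Ω'} [IsProbabilityMeasure P'] {X : Ω' → Vec p} {sample : ℕ → Ω → Vec p}
    (hindep : ProbabilityTheory.iIndepFun sample P)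
    (hident : ∀ k, ProbabilityTheory.IdentDistrib (sample k) X P P')
    (hX : Integrable X P') (u : Finset (Fin d)) (s : Fin d → Finset (Fin d)) :
    ∑ c ∈ u, distCovSq P' (fun ω => comp c (X ω)) (fun ω => subvec (s c) (X ω)) < ⊤ ∧
    ∀ᵐ ω ∂P, Filter.Tendsto
      (fun n : ℕ => ∑ c ∈ u, empDistCovSq n (fun k => comp c (sample k ω))
        (fun k => subvec (s c) (sample k ω))) Filter.atTop
      (nhds (∑ c ∈ u, distCovSq P' (fun ω => comp c (X ω)) (fun ω => subvec (s c) (X ω)))) := by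
  have h : ∀ c, _ := fun c => by
    have hg : Continuous fun x : Vec p => (comp c x, subvec (s c) x) :=
      (continuous_comp c).prodMk (continuous_subvec (s c))
    -- The pair carries the maximum norm, so its integrability follows from the two projection
    -- bounds.
    exact distCovSq_lt_top_and_ae_tendsto (hindep.comp (fun _ => _) fun _ => hg.measurable)
      (fun k => (hident k).comp hg.measurable)
      (hX.mono (hg.comp_aestronglyMeasurable hX.1) (Filter.Eventually.of_forall fun ω =>
        max_le (norm_comp_le c (X ω)) (norm_subvec_le (s c) (X ω))))
  refine ⟨ENNReal.sum_lt_top.2 fun c _ => (h c).1, ?_⟩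
  filter_upwards [ae_all_iff.2 fun c => (h c).2] with ω hω
  exact tendsto_finsetSum _ fun c _ => hω c

end Consistency

end MutualDependence

end

theorem mainTheorem7 {d : ℕ} (p : Fin d → ℕ)
    {Ω Ω' : Type*} [MeasurableSpace Ω] [MeasurableSpace Ω']
    (P : MeasureTheory.Measure Ω) [MeasureTheory.IsProbabilityMeasure P]
    (P' : MeasureTheory.Measure Ω') [MeasureTheory.IsProbabilityMeasure P']
    (X : Ω' → MutualDependence.Vec p)
    (sample : ℕ → Ω → MutualDependence.Vec p)
    (hindep : ProbabilityTheory.iIndepFun sample P)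
    (hident : ∀ k, ProbabilityTheory.IdentDistrib (sample k) X P P')
    (hX : MeasureTheory.Integrable X P') :
    MutualDependence.asymMeasure P' X < ⊤ ∧ MutualDependence.symMeasure P' X < ⊤ ∧
    (∀ᵐ ω ∂P, Filter.Tendsto
      (fun n : ℕ => MutualDependence.empAsymMeasure n (fun k => sample k ω))
      Filter.atTop (nhds (MutualDependence.asymMeasure P' X))) ∧
    (∀ᵐ ω ∂P, Filter.Tendsto
      (fun n : ℕ => MutualDependence.empSymMeasure n (fun k => sample k ω))
      Filter.atTop (nhds (MutualDependence.symMeasure P' X))) := by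
  have hR := MutualDependence.sum_distCovSq_lt_top_and_ae_tendsto hindep hident hX
    (Finset.univ.filter fun c : Fin d => (c : ℕ) + 1 < d) Finset.Ioi
  have hS := MutualDependence.sum_distCovSq_lt_top_and_ae_tendsto hindep hident hX
    Finset.univ Finset.univ.erase
  exact ⟨hR.1, hS.1, hR.2, hS.2⟩
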